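/- Let $G$ and $H$ be locally compact, second countable, Hausdorff topological groups, and let $K\subseteq G$ and $L\subseteq H$ be compact sets that generate $G$ and $H$ as abstract groups, respectively (so $G$ and $H$ are compactly generated). Let $\rho_K(g,g')$ be the least $n\ge 0$ such that $g^{-1}g'$ is a product of $n$ elements of $K\cup K^{-1}$, and define $\rho_L$ on $H$ likewise. Then $(G,\rho_K)$ and $(H,\rho_L)$ are quasi-isometric if and only if $G$ and $H$ admit a topological coupling. Here a quasi-isometry $(G,\rho_K)\to(H,\rho_L)$ is a map $\phi\colon G\to H$ for which there are constants $\lambda\ge 1$ and $C\ge 0$ such that $$\lambda^{-1}\rho_K(x,z)-C\;\le\;\rho_L(\phi(x),\phi(z))\;\le\;\lambda\,\rho_K(x,z)+C\qquad\text{for all }x,z\in G,$$ and every $y\in H$ satisfies $\rho_L(y,\phi(x))\le C$ for some $x\in G$; the two spaces are quasi-isometric if such a map exists. A topological coupling of $G$ and $H$ is a nonempty locally compact Hausdorff space $X$ with a (jointly) continuous left action of $G$ and a (jointly) continuous right action of $H$ that commute, such that * (properness) for every compact $C\subseteq X$, the sets $\{g\in G: gC\cap C\ne\emptyset\}$ and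 $\{h\in H: Ch\cap C\ne\emptyset\}$ are compact; * (cocompactness) there is a compact $C\subseteq X$ with $X=G\cdot C=C\cdot H$. -/

import Mathlib

open scoped Pointwise

universe u v w

/-- Word length of `g` with respect to `K`: the least length of a word in `K ∪ K⁻¹` with
product `g`. (Meaningful when `K` generates the group.) -/
noncomputable def wordLength {G : Type u} [Group G] (K : Set G) (g : G) : ℕ :=
  sInf {n : ℕ | ∃ l : List G, l.length = n ∧ (∀ x ∈ l, x ∈ K ∪ K⁻¹) ∧ l.prod = g}

/-- The left-invariant word metric `ρ_K(g, h) = |g⁻¹ h|_K`. -/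
noncomputable def wordDist {G : Type u} [Group G] (K : Set G) (g h : G) : ℝ :=
  wordLength K (g⁻¹ * h)

/-- `φ` is a quasi-isometry from `α` with the distance function `dα` to `β` with the distance
function `dβ`: affine lower and upper bounds, and cobounded image. -/
def IsQuasiIsometry {α : Type u} {β : Type v} (dα : α → α → ℝ) (dβ : β → β → ℝ)
    (φ : α → β) : Prop :=
  ∃ L C : ℝ, 1 ≤ L ∧ 0 ≤ C ∧
    (∀ x z : α, L⁻¹ * dα x z - C ≤ dβ (φ x) (φ z) ∧ dβ (φ x) (φ z) ≤ L * dα x z + C) ∧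
    ∀ y : β, ∃ x : α, dβ y (φ x) ≤ C

/-- The space `X`, with a left action of `G` and a right action of `H` (that is, an action of
`Hᵐᵒᵖ`), is a topological coupling of `G` and `H`. -/
structure IsTopologicalCoupling (G : Type u) (H : Type v) (X : Type w)
    [Group G] [TopologicalSpace G] [Group H] [TopologicalSpace H]
    [TopologicalSpace X] [MulAction G X] [MulAction Hᵐᵒᵖ X] : Prop where
  nonempty : Nonempty X
  t2Space : T2Space X
  locallyCompactSpace : LocallyCompactSpace X
  continuous_left : Continuous fun p : G × X => p.1 • p.2
  continuous_right : Continuous fun p : X × H => MulOpposite.op p.2 • p.1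
  comm : ∀ (g : G) (h : H) (x : X),
    g • (MulOpposite.op h • x) = MulOpposite.op h • (g • x)
  proper_left : ∀ C : Set X, IsCompact C → IsCompact {g : G | ((g • C) ∩ C).Nonempty}
  proper_right : ∀ C : Set X, IsCompact C →
    IsCompact {h : H | ((MulOpposite.op h • C) ∩ C).Nonempty}
  cocompact : ∃ C : Set X, IsCompact C ∧
    (⋃ g : G, g • C) = Set.univ ∧ (⋃ h : H, MulOpposite.op h • C) = Set.univ

/-- `G` and `H` admit a topological coupling (on a space in the universe `w`). -/
def AdmitTopologicalCoupling (G : Type u) (H : Type v)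
    [Group G] [TopologicalSpace G] [Group H] [TopologicalSpace H] : Prop :=
  ∃ (X : Type w) (_ : TopologicalSpace X) (_ : MulAction G X) (_ : MulAction Hᵐᵒᵖ X),
    IsTopologicalCoupling G H X

/-!
Both conditions say that there is a coarse correspondence between `G` and `H`: a relation
`R ⊆ G × H`, total on both sides, that is coarsely Lipschitz in both directions.

Given a coupling `X` with base point `x₀` and compact fundamental set `C`, let `R` consist of the
pairs `(g, h)` with `g⁻¹ x₀ h ∈ C`. Cocompactness makes `R` total; along one generator step of one
variable, properness keeps the other variable within bounded distance.

Conversely, smear `R` out to the function `f p = ⨆ r ∈ R, b (r⁻¹ p)` on `G × H`, where `b` is a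
bump function at `1`. The coupling space consists of the nonzero functions `G × H → [0, 1]` that
have the same modulus of continuity and the same coarse constants as `f`, in the topology of
pointwise convergence, with `G × H` acting by translation. Together with `0` these functions form a
closed subset of the Tychonoff cube, so they form a locally compact space. The common modulus makes
the action continuous, and the two coarse Lipschitz bounds make the actions of `G` and `H` proper.
-/

open Filter Topology

section WordLength

variable {G : Type*} [Group G] {K : Set G}

/-- The closed ball of radius `n` about `1` for the word length. -/
def wordBall (K : Set G) (n : ℕ) : Set G :=
  {g | wordLength K g ≤ n}

theorem mem_wordBall {n : ℕ} {g : G} : g ∈ wordBall K n ↔ wordLength K g ≤ n :=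
  Iff.rfl

theorem wordBall_mono : Monotone (wordBall K) :=
  fun _ _ hmn _ hg => le_trans hg hmn

theorem wordLength_prod_le {l : List G} (hl : ∀ x ∈ l, x ∈ K ∪ K⁻¹) :
    wordLength K l.prod ≤ l.length :=
  Nat.sInf_le ⟨l, rfl, hl, rfl⟩

theorem wordLength_one : wordLength K (1 : G) = 0 :=
  Nat.le_zero.1 (wordLength_prod_le (l := []) (by simp))

theorem exists_prod_eq_and_length_eq_wordLength (hK : Subgroup.closure K = ⊤) (g : G) :
    ∃ l : List G, l.length = wordLength K g ∧ (∀ x ∈ l, x ∈ K ∪ K⁻¹) ∧ l.prod = g := by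
  have hg : g ∈ (Subgroup.closure K).toSubmonoid := hK ▸ Subgroup.mem_top g
  rw [Subgroup.closure_toSubmonoid] at hg
  obtain ⟨l, hl, hprod⟩ := Submonoid.exists_list_of_mem_closure hg
  exact Nat.sInf_mem (s := {n | ∃ l : List G, l.length = n ∧ (∀ x ∈ l, x ∈ K ∪ K⁻¹) ∧ l.prod = g})
    ⟨l.length, l, rfl, hl, hprod⟩

theorem wordLength_mul_le (hK : Subgroup.closure K = ⊤) (g h : G) :
    wordLength K (g * h) ≤ wordLength K g + wordLength K h := by
  obtain ⟨l, hl, hlK, rfl⟩ := exists_prod_eq_and_length_eq_wordLength hK g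
  obtain ⟨m, hm, hmK, rfl⟩ := exists_prod_eq_and_length_eq_wordLength hK h
  rw [← hl, ← hm, ← List.prod_append, ← List.length_append]
  exact wordLength_prod_le fun x hx => (List.mem_append.1 hx).elim (hlK x) (hmK x)

theorem wordLength_inv (hK : Subgroup.closure K = ⊤) (g : G) :
    wordLength K g⁻¹ = wordLength K g := by
  have inv_le (g : G) : wordLength K g⁻¹ ≤ wordLength K g := by
    obtain ⟨l, hl, hlK, rfl⟩ := exists_prod_eq_and_length_eq_wordLength hK g
    rw [← hl, List.prod_inv_reverse]
    refine (wordLength_prod_le fun x hx => ?_).trans (by simp)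
    obtain ⟨y, hy, rfl⟩ := List.mem_map.1 (List.mem_reverse.1 hx)
    simpa [or_comm] using hlK y hy
  exact (inv_le g).antisymm (by simpa using inv_le g⁻¹)

theorem wordLength_inv_mul_comm (hK : Subgroup.closure K = ⊤) (x y : G) :
    wordLength K (x⁻¹ * y) = wordLength K (y⁻¹ * x) := by
  rw [← wordLength_inv hK, mul_inv_rev, inv_inv]

theorem wordLength_inv_mul_le (hK : Subgroup.closure K = ⊤) (x y z : G) :
    wordLength K (x⁻¹ * z) ≤ wordLength K (x⁻¹ * y) + wordLength K (y⁻¹ * z) := by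
  simpa [mul_assoc] using wordLength_mul_le hK (x⁻¹ * y) (y⁻¹ * z)

theorem wordBall_zero (hK : Subgroup.closure K = ⊤) : wordBall K 0 = {1} := by
  ext g
  rw [mem_wordBall, Nat.le_zero, Set.mem_singleton_iff]
  refine ⟨fun hg => ?_, fun hg => hg ▸ wordLength_one⟩
  obtain ⟨l, hl, -, rfl⟩ := exists_prod_eq_and_length_eq_wordLength hK g
  rw [List.length_eq_zero_iff.1 (hl.trans hg), List.prod_nil]

theorem wordBall_succ (hK : Subgroup.closure K = ⊤) (n : ℕ) :
    wordBall K (n + 1) = insert 1 (K ∪ K⁻¹) * wordBall K n := by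
  ext g
  constructor
  · intro hg
    obtain ⟨l, hl, hlK, rfl⟩ := exists_prod_eq_and_length_eq_wordLength hK g
    rw [mem_wordBall, ← hl] at hg
    cases l with
    | nil => exact ⟨1, Or.inl rfl, 1, by simp [mem_wordBall, wordLength_one], by simp⟩
    | cons s m =>
      have hm : wordLength K m.prod ≤ m.length :=
        wordLength_prod_le fun x hx => hlK x (List.mem_cons_of_mem s hx)
      exact ⟨s, Or.inr (hlK s List.mem_cons_self), m.prod,
        hm.trans (Nat.succ_le_succ_iff.1 hg), List.prod_cons.symm⟩
  · rintro ⟨s, hs, t, ht, rfl⟩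
    have hs_le : wordLength K s ≤ 1 := by
      rcases hs with rfl | hs
      · simp [wordLength_one]
      · simpa using wordLength_prod_le (l := [s]) (by simpa using hs)
    exact (wordLength_mul_le hK s t).trans (by rw [mem_wordBall] at ht; omega)

variable [TopologicalSpace G] [IsTopologicalGroup G]

theorem isCompact_wordBall (hKc : IsCompact K) (hK : Subgroup.closure K = ⊤) (n : ℕ) :
    IsCompact (wordBall K n) := by
  induction n with
  | zero => rw [wordBall_zero hK]; exact isCompact_singleton
  | succ n ih => rw [wordBall_succ hK]; exact ((hKc.union hKc.inv).insert 1).mul ih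

/- By Baire some ball has an interior point `u`, and then `u⁻¹ * B n ⊆ B (2 n)` is a neighbourhood
of `1`. -/
theorem exists_wordBall_mem_nhds_one [T2Space G] [BaireSpace G] (hKc : IsCompact K)
    (hK : Subgroup.closure K = ⊤) : ∃ n, wordBall K n ∈ 𝓝 (1 : G) := by
  obtain ⟨n, u, hu⟩ := nonempty_interior_of_iUnion_of_closed
    (fun n => (isCompact_wordBall hKc hK n).isClosed)
    (Set.iUnion_eq_univ_iff.2 fun g => ⟨wordLength K g, le_refl (wordLength K g)⟩)
  have hball : wordBall K n ∈ 𝓝 (u * 1) := by simpa using mem_interior_iff_mem_nhds.1 hu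
  refine ⟨n + n, mem_of_superset ((continuous_const_mul u).continuousAt hball) fun g hg => ?_⟩
  have hu_le : u ∈ wordBall K n := interior_subset hu
  calc wordLength K g = wordLength K (u⁻¹ * (u * g)) := by rw [inv_mul_cancel_left]
    _ ≤ wordLength K u⁻¹ + wordLength K (u * g) := wordLength_mul_le hK _ _
    _ ≤ n + n := add_le_add (by rwa [wordLength_inv hK]) hg

theorem exists_subset_wordBall_of_isCompact [T2Space G] [BaireSpace G] (hKc : IsCompact K)
    (hK : Subgroup.closure K = ⊤) {D : Set G} (hD : IsCompact D) : ∃ n, D ⊆ wordBall K n := by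
  obtain ⟨n, hn⟩ := exists_wordBall_mem_nhds_one hKc hK
  have hmono : Monotone fun m => interior (wordBall K m) :=
    fun _ _ hmn => interior_mono (wordBall_mono hmn)
  have hcover : D ⊆ ⋃ m, interior (wordBall K m) := by
    refine fun d _ => Set.mem_iUnion.2 ⟨wordLength K d + n, mem_interior_iff_mem_nhds.2 ?_⟩
    have hd : wordBall K n ∈ 𝓝 (d⁻¹ * d) := by rwa [inv_mul_cancel]
    refine mem_of_superset ((continuous_const_mul d⁻¹).continuousAt hd) fun g hg => ?_
    calc wordLength K g = wordLength K (d * (d⁻¹ * g)) := by rw [mul_inv_cancel_left]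
      _ ≤ wordLength K d + wordLength K (d⁻¹ * g) := wordLength_mul_le hK _ _
      _ ≤ wordLength K d + n := Nat.add_le_add_left hg _
  obtain ⟨m, hm⟩ := hD.elim_directed_cover _ (fun _ => isOpen_interior) hcover hmono.directed_le
  exact ⟨m, hm.trans interior_subset⟩

end WordLength

section CoarseCorrespondence

variable {G : Type*} {H : Type*} [Group G] [Group H] {K : Set G} {L : Set H} {A : ℕ}
  {R : G → H → Prop}

/-- The relation `R`, regarded as a multivalued map from `G` to `H`, is coarsely Lipschitz for the
word metrics. A single constant `A` serves as slope and as additive error. -/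
def CoarselyLipschitz (K : Set G) (L : Set H) (A : ℕ) (R : G → H → Prop) : Prop :=
  ∀ ⦃x y x' y'⦄, R x y → R x' y' →
    wordLength L (y⁻¹ * y') ≤ A * wordLength K (x⁻¹ * x') + A

/-- A correspondence between `G` and `H` that is coarsely Lipschitz in both directions: the
multivalued, symmetric form of a quasi-isometry. -/
structure IsCoarseCorrespondence (K : Set G) (L : Set H) (R : G → H → Prop) : Prop where
  leftTotal : Relator.LeftTotal R
  rightTotal : Relator.RightTotal R
  lipschitz : ∃ A, CoarselyLipschitz K L A R
  lipschitz_flip : ∃ A, CoarselyLipschitz L K A (flip R)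

theorem CoarselyLipschitz.of_close (hK : Subgroup.closure K = ⊤) (hL : Subgroup.closure L = ⊤)
    (hR : CoarselyLipschitz K L A R) {n : ℕ} {R' : G → H → Prop}
    (hclose : ∀ ⦃x y⦄, R' x y → ∃ a b, R a b ∧ a⁻¹ * x ∈ wordBall K n ∧ b⁻¹ * y ∈ wordBall L n) :
    CoarselyLipschitz K L (2 * n * A + 2 * n + A) R' := by
  intro x y x' y' h h'
  obtain ⟨a, b, hab, hax, hby⟩ := hclose h
  obtain ⟨a', b', hab', hax', hby'⟩ := hclose h'
  rw [mem_wordBall] at hax hby hax' hby'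
  have ha : wordLength K (a⁻¹ * a') ≤ wordLength K (x⁻¹ * x') + 2 * n := by
    have h₁ := wordLength_inv_mul_le hK a x a'
    have h₂ := wordLength_inv_mul_le hK x x' a'
    rw [wordLength_inv_mul_comm hK x' a'] at h₂
    omega
  have hy : wordLength L (y⁻¹ * y') ≤ wordLength L (b⁻¹ * b') + 2 * n := by
    have h₁ := wordLength_inv_mul_le hL y b y'
    have h₂ := wordLength_inv_mul_le hL b b' y'
    rw [wordLength_inv_mul_comm hL y b] at h₁
    omega
  calc wordLength L (y⁻¹ * y') ≤ wordLength L (b⁻¹ * b') + 2 * n := hy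
    _ ≤ A * wordLength K (a⁻¹ * a') + A + 2 * n := by gcongr; exact hR hab hab'
    _ ≤ A * (wordLength K (x⁻¹ * x') + 2 * n) + A + 2 * n := by gcongr
    _ = A * wordLength K (x⁻¹ * x') + (2 * n * A + 2 * n + A) := by ring
    _ ≤ (2 * n * A + 2 * n + A) * wordLength K (x⁻¹ * x') + (2 * n * A + 2 * n + A) := by
      gcongr
      exact Nat.le_add_left _ _

theorem CoarselyLipschitz.of_generators (hK : Subgroup.closure K = ⊤)
    (hL : Subgroup.closure L = ⊤) (hR : Relator.LeftTotal R)
    (hstep : ∀ ⦃x y s y'⦄, s ∈ insert 1 (K ∪ K⁻¹) → R x y → R (x * s) y' →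
      y⁻¹ * y' ∈ wordBall L A) :
    CoarselyLipschitz K L A R := by
  suffices ∀ n, ∀ t ∈ wordBall K n, ∀ x y y', R x y → R (x * t) y' →
      wordLength L (y⁻¹ * y') ≤ A * n + A from fun x y x' y' h h' =>
    this _ (x⁻¹ * x') (le_refl (wordLength K (x⁻¹ * x'))) x y y' h (by rwa [mul_inv_cancel_left])
  intro n
  induction n with
  | zero =>
    intro t ht x y y' h h'
    rw [wordBall_zero hK] at ht
    simpa [mem_wordBall] using hstep (Or.inl ht) h h'
  | succ n ih =>
    intro t ht x y y' h h'
    rw [wordBall_succ hK] at ht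
    obtain ⟨s, hs, t, ht, rfl⟩ := ht
    obtain ⟨z, hz⟩ := hR (x * s)
    calc wordLength L (y⁻¹ * y') ≤ wordLength L (y⁻¹ * z) + wordLength L (z⁻¹ * y') :=
          wordLength_inv_mul_le hL y z y'
      _ ≤ A + (A * n + A) :=
          add_le_add (hstep hs h hz) (ih t ht (x * s) z y' hz (by rwa [mul_assoc]))
      _ = A * (n + 1) + A := by ring

theorem exists_coarselyLipschitz_of_wordDist_le {a c : ℝ}
    (h : ∀ ⦃x y x' y'⦄, R x y → R x' y' → wordDist L y y' ≤ a * wordDist K x x' + c) :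
    ∃ A, CoarselyLipschitz K L A R := by
  refine ⟨⌈max a c⌉₊, fun x y x' y' hxy hxy' => ?_⟩
  have ha : a ≤ ⌈max a c⌉₊ := (le_max_left a c).trans (Nat.le_ceil _)
  have hc : c ≤ ⌈max a c⌉₊ := (le_max_right a c).trans (Nat.le_ceil _)
  have hbound : wordDist L y y' ≤ ⌈max a c⌉₊ * wordDist K x x' + ⌈max a c⌉₊ :=
    (h hxy hxy').trans (by gcongr; exact Nat.cast_nonneg _)
  unfold wordDist at hbound
  exact_mod_cast hbound

theorem IsCoarseCorrespondence.exists_isQuasiIsometry (hR : IsCoarseCorrespondence K L R) :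
    ∃ φ : G → H, IsQuasiIsometry (wordDist K) (wordDist L) φ := by
  obtain ⟨A, hA⟩ := hR.lipschitz
  obtain ⟨B, hB⟩ := hR.lipschitz_flip
  have upper {x y x' y'} (h : R x y) (h' : R x' y') :
      wordDist L y y' ≤ A * wordDist K x x' + A := by
    unfold wordDist; exact_mod_cast hA h h'
  have lower {x y x' y'} (h : R x y) (h' : R x' y') :
      wordDist K x x' ≤ B * wordDist L y y' + B := by
    unfold wordDist; exact_mod_cast hB h h'
  have distG (x x' : G) : 0 ≤ wordDist K x x' := Nat.cast_nonneg _
  have distH (y y' : H) : 0 ≤ wordDist L y y' := Nat.cast_nonneg _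
  have : (0 : ℝ) ≤ A := A.cast_nonneg
  have : (0 : ℝ) ≤ B := B.cast_nonneg
  choose φ hφ using hR.leftTotal
  refine ⟨φ, A + B + 1, A + B, by linarith, by positivity, fun x z => ⟨?_, ?_⟩, fun y => ?_⟩
  · rw [sub_le_iff_le_add, inv_mul_le_iff₀ (by positivity)]
    calc wordDist K x z ≤ B * wordDist L (φ x) (φ z) + B := lower (hφ x) (hφ z)
      _ ≤ (A + B + 1) * wordDist L (φ x) (φ z) + (A + B + 1) * (A + B) := by
        gcongr
        · exact distH _ _
        · linarith
        · nlinarith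
      _ = (A + B + 1) * (wordDist L (φ x) (φ z) + (A + B)) := by ring
  · calc wordDist L (φ x) (φ z) ≤ A * wordDist K x z + A := upper (hφ x) (hφ z)
      _ ≤ (A + B + 1) * wordDist K x z + (A + B) := by
        gcongr
        · exact distG _ _
        · linarith
        · linarith
  · obtain ⟨x, hx⟩ := hR.rightTotal y
    have hdiag : wordDist K x x = 0 := by simp [wordDist, wordLength_one]
    exact ⟨x, (upper hx (hφ x)).trans (by rw [hdiag]; linarith)⟩

theorem IsQuasiIsometry.exists_isCoarseCorrespondence (hK : Subgroup.closure K = ⊤)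
    (hL : Subgroup.closure L = ⊤) {φ : G → H}
    (hφ : IsQuasiIsometry (wordDist K) (wordDist L) φ) :
    ∃ R, IsCoarseCorrespondence K L R := by
  obtain ⟨l, C, hl, -, hdist, hcob⟩ := hφ
  have hgraph : ∃ A, CoarselyLipschitz K L A fun x y => φ x = y :=
    exists_coarselyLipschitz_of_wordDist_le (a := l) (c := C) <| by
      rintro x _ x' _ rfl rfl
      exact (hdist x x').2
  have hgraph_flip : ∃ A, CoarselyLipschitz L K A (flip fun x y => φ x = y) :=
    exists_coarselyLipschitz_of_wordDist_le (a := l) (c := l * C) <| by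
      rintro _ x _ x' rfl rfl
      have := (hdist x x').1
      rwa [sub_le_iff_le_add, inv_mul_le_iff₀ (by positivity), mul_add] at this
  have hone (x : G) : x⁻¹ * x ∈ wordBall K ⌈C⌉₊ := by simp [mem_wordBall, wordLength_one]
  refine ⟨fun x y => (φ x)⁻¹ * y ∈ wordBall L ⌈C⌉₊, fun x => ⟨φ x, ?_⟩, fun y => ?_, ?_, ?_⟩
  · simp [mem_wordBall, wordLength_one]
  · obtain ⟨x, hx⟩ := hcob y
    refine ⟨x, ?_⟩
    rw [mem_wordBall, wordLength_inv_mul_comm hL]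
    have hceil : wordDist L y (φ x) ≤ ⌈C⌉₊ := hx.trans (Nat.le_ceil C)
    unfold wordDist at hceil
    exact_mod_cast hceil
  · obtain ⟨A, hA⟩ := hgraph
    exact ⟨_, hA.of_close hK hL fun x y hxy => ⟨x, φ x, rfl, hone x, hxy⟩⟩
  · obtain ⟨A, hA⟩ := hgraph_flip
    exact ⟨_, hA.of_close hL hK fun y x hxy => ⟨φ x, x, rfl, hxy, hone x⟩⟩

end CoarseCorrespondence

section LeftModulus

theorem isClosed_setOf_exists_mem_of_isCompact {X Y : Type*} [TopologicalSpace X]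
    [TopologicalSpace Y] {S : Set Y} (hS : IsCompact S) {Z : Set (X × Y)} (hZ : IsClosed Z) :
    IsClosed {x | ∃ y ∈ S, (x, y) ∈ Z} := by
  have : CompactSpace S := isCompact_iff_compactSpace.1 hS
  have hZS : IsClosed {p : X × S | (p.1, (p.2 : Y)) ∈ Z} := hZ.preimage (by fun_prop)
  convert isClosedMap_fst_of_compactSpace _ hZS using 1
  ext x
  simp

variable {Γ : Type*} [Group Γ] {Y : Type*} [PseudoMetricSpace Y] {W : Γ → ℝ}

/-- `W` is a modulus of continuity of `f` under right translations of the argument; the notion is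
invariant under left translations. -/
def HasLeftModulus (W : Γ → ℝ) (f : Γ → Y) : Prop :=
  ∀ p q, dist (f p) (f q) ≤ W (p⁻¹ * q)

theorem HasLeftModulus.comp_mul_left {f : Γ → Y} (hf : HasLeftModulus W f) (γ : Γ) :
    HasLeftModulus W fun p => f (γ * p) :=
  fun p q => by simpa [mul_assoc] using hf (γ * p) (γ * q)

theorem isClosed_setOf_hasLeftModulus : IsClosed {f : Γ → Y | HasLeftModulus W f} := by
  simp only [HasLeftModulus, Set.ofPred_forall]
  exact isClosed_iInter fun p => isClosed_iInter fun q =>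
    isClosed_le (by fun_prop) continuous_const

theorem dist_iSup_iSup_le {ι : Type*} [Nonempty ι] {f g : ι → unitInterval} {c : ℝ}
    (h : ∀ i, dist (f i) (g i) ≤ c) : dist (⨆ i, f i) (⨆ i, g i) ≤ c := by
  have iSup_le_add {f g : ι → unitInterval} (h : ∀ i, dist (f i) (g i) ≤ c) :
      ((⨆ i, f i : unitInterval) : ℝ) ≤ (⨆ i, g i : unitInterval) + c := by
    rw [Set.Icc.coe_iSup zero_le_one]
    refine ciSup_le fun i => ?_
    have hfg : (f i : ℝ) - g i ≤ c := (le_abs_self _).trans (h i)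
    have hg : (g i : ℝ) ≤ (⨆ i, g i : unitInterval) := le_iSup g i
    linarith
  have hfg := iSup_le_add h
  have hgf := iSup_le_add fun i => (dist_comm (g i) (f i)).trans_le (h i)
  rw [Subtype.dist_eq, Real.dist_eq, abs_sub_le_iff]
  constructor <;> linarith

/-- The supremum of the left translates of `b` by the elements of `R`: a continuous substitute for
the indicator function of `R`. -/
noncomputable def smear (R : Set Γ) (b : Γ → unitInterval) (p : Γ) : unitInterval :=
  ⨆ r : R, b ((r : Γ)⁻¹ * p)

section Smear

variable {R : Set Γ} {b : Γ → unitInterval}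

theorem HasLeftModulus.smear (hb : HasLeftModulus W b) (hR : R.Nonempty) :
    HasLeftModulus W (smear R b) := by
  have := hR.to_subtype
  exact fun p q => dist_iSup_iSup_le fun r => hb.comp_mul_left (r : Γ)⁻¹ p q

theorem smear_eq_one (hb : b 1 = 1) {r : Γ} (hr : r ∈ R) : smear R b r = 1 :=
  le_antisymm unitInterval.le_one' <|
    le_iSup_of_le (⟨r, hr⟩ : R) (by rw [inv_mul_cancel, hb])

theorem exists_mem_of_smear_ne_zero {p : Γ} (hp : smear R b p ≠ 0) :
    ∃ r ∈ R, r⁻¹ * p ∈ Function.support b := by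
  by_contra! h
  exact hp (iSup_eq_bot.2 fun r => Function.notMem_support.1 (h r r.2))

end Smear

variable [TopologicalSpace Γ] [IsTopologicalGroup Γ]

theorem continuous_uncurry_of_hasLeftModulus {ι : Type*} [TopologicalSpace ι] {F : ι → Γ → Y}
    (hW : Tendsto W (𝓝 1) (𝓝 0)) (hmod : ∀ i, HasLeftModulus W (F i))
    (hF : ∀ p, Continuous fun i => F i p) : Continuous fun q : ι × Γ => F q.1 q.2 := by
  refine continuous_iff_continuousAt.2 fun ⟨i₀, p₀⟩ => tendsto_iff_dist_tendsto_zero.2 ?_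
  have hmod₀ : Tendsto (fun q : ι × Γ => W (q.2⁻¹ * p₀)) (𝓝 (i₀, p₀)) (𝓝 0) :=
    hW.comp (Continuous.tendsto' (by fun_prop) _ _ (inv_mul_cancel p₀))
  have hF₀ : Tendsto (fun q : ι × Γ => dist (F q.1 p₀) (F i₀ p₀)) (𝓝 (i₀, p₀)) (𝓝 0) :=
    (((hF p₀).comp continuous_fst).dist continuous_const).tendsto' _ _ (dist_self _)
  refine squeeze_zero (fun _ => dist_nonneg) (fun q => ?_) (by simpa using hmod₀.add hF₀)
  exact (dist_triangle _ (F q.1 p₀) _).trans (add_le_add_left (hmod q.1 _ _) _)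

theorem isClosed_setOf_hasLeftModulus_and_exists_eq {B : Set Γ} [T1Space Y]
    (hW : Tendsto W (𝓝 1) (𝓝 0)) (hB : IsCompact B) (y : Y) :
    IsClosed {f : Γ → Y | HasLeftModulus W f ∧ ∃ p ∈ B, f p = y} := by
  let M := {f : Γ → Y | HasLeftModulus W f}
  have heval : Continuous fun q : M × Γ => q.1.1 q.2 :=
    continuous_uncurry_of_hasLeftModulus hW (fun f => f.2)
      fun p => (continuous_apply p).comp continuous_subtype_val
  have hclosed : IsClosed {f : M | ∃ p ∈ B, f.1 p = y} :=
    isClosed_setOf_exists_mem_of_isCompact hB (isClosed_singleton.preimage heval)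
  convert isClosed_setOf_hasLeftModulus.isClosedEmbedding_subtypeVal.isClosedMap _ hclosed using 1
  ext f
  exact ⟨fun ⟨hf, hfB⟩ => ⟨⟨f, hf⟩, hfB, rfl⟩, by rintro ⟨f, hfB, rfl⟩; exact ⟨f.2, hfB⟩⟩

theorem exists_hasLeftModulus_of_hasCompactSupport [Zero Y] [BoundedSpace Y] {f : Γ → Y}
    (hf : Continuous f) (hsupp : HasCompactSupport f) :
    ∃ W : Γ → ℝ, Tendsto W (𝓝 1) (𝓝 0) ∧ HasLeftModulus W f := by
  have hbdd (u : Γ) : BddAbove (Set.range fun p => dist (f p) (f (p * u))) :=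
    ⟨Metric.diam (Set.univ : Set Y), by
      rintro _ ⟨p, rfl⟩
      exact Metric.dist_le_diam_of_mem (Bornology.IsBounded.all _) trivial trivial⟩
  refine ⟨fun u => ⨆ p, dist (f p) (f (p * u)), Metric.tendsto_nhds.2 fun ε hε => ?_,
    fun p q => by simpa using le_ciSup (hbdd (p⁻¹ * q)) p⟩
  let _ : UniformSpace Γ := IsTopologicalGroup.leftUniformSpace Γ
  have hunif := hsupp.uniformContinuous_of_continuous hf (Metric.dist_mem_uniformity (half_pos hε))
  rw [mem_map, uniformity_eq_comap_nhds_one_left, mem_comap] at hunif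
  obtain ⟨U, hU, hUε⟩ := hunif
  filter_upwards [hU] with u hu
  have hle : ⨆ p, dist (f p) (f (p * u)) ≤ ε / 2 :=
    ciSup_le fun p => (hUε (a := (p, p * u)) (by simpa using hu)).le
  rw [Real.dist_0_eq_abs, abs_of_nonneg (Real.iSup_nonneg fun _ => dist_nonneg)]
  linarith

end LeftModulus

section CoarseKernel

variable {G : Type*} {H : Type*} [Group G] [Group H] {K : Set G} {L : Set H}
  {W : G × H → ℝ} {A B : ℕ} {f : G × H → unitInterval}

/-- The function `f` has modulus `W`, its support is coarsely Lipschitz as a multivalued map from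
`G` to `H`, and, unless `f` vanishes, already the set where `f = 1` is total over `G`. Allowing
`f = 0` makes the set of such functions closed under pointwise limits. -/
structure IsCoarseMapKernel (K : Set G) (L : Set H) (W : G × H → ℝ) (A : ℕ)
    (f : G × H → unitInterval) : Prop where
  hasLeftModulus : HasLeftModulus W f
  lipschitz : CoarselyLipschitz K L A fun x y => f (x, y) ≠ 0
  leftTotal : f ≠ 0 → Relator.LeftTotal fun x y => f (x, y) = 1

/-- A continuous `[0, 1]`-valued substitute for a coarse correspondence: both `f` and its transpose
satisfy `IsCoarseMapKernel`. -/
def IsCoarseKernel (K : Set G) (L : Set H) (W : G × H → ℝ) (A B : ℕ)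
    (f : G × H → unitInterval) : Prop :=
  IsCoarseMapKernel K L W A f ∧ IsCoarseMapKernel L K (W ∘ Prod.swap) B (f ∘ Prod.swap)

theorem IsCoarseMapKernel.comp_mul_left (hf : IsCoarseMapKernel K L W A f) (γ : G × H) :
    IsCoarseMapKernel K L W A fun p => f (γ * p) where
  hasLeftModulus := hf.hasLeftModulus.comp_mul_left γ
  lipschitz x y x' y' h h' := by simpa [mul_assoc] using hf.lipschitz h h'
  leftTotal hne x := by
    obtain ⟨y, hy⟩ := hf.leftTotal (fun h => hne (by rw [h]; rfl)) (γ.1 * x)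
    exact ⟨γ.2⁻¹ * y, by simpa [Prod.mul_def] using hy⟩

theorem IsCoarseKernel.comp_mul_left (hf : IsCoarseKernel K L W A B f) (γ : G × H) :
    IsCoarseKernel K L W A B fun p => f (γ * p) :=
  ⟨hf.1.comp_mul_left γ, hf.2.comp_mul_left γ.swap⟩

theorem isClosed_setOf_coarselyLipschitz {X : Type*} [TopologicalSpace X] {R : X → G → H → Prop}
    (hR : ∀ x y, IsOpen {i | R i x y}) : IsClosed {i | CoarselyLipschitz K L A (R i)} := by
  simp only [CoarselyLipschitz, Set.ofPred_forall]
  exact isClosed_iInter fun x => isClosed_iInter fun y => isClosed_iInter fun x' =>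
    isClosed_iInter fun y' => isClosed_imp (hR x y) (isClosed_imp (hR x' y') isClosed_const)

theorem isCoarseMapKernel_iff : IsCoarseMapKernel K L W A f ↔
    CoarselyLipschitz K L A (fun x y => f (x, y) ≠ 0) ∧ HasLeftModulus W f ∧
      ∀ x y x', f (x, y) ≠ 0 → HasLeftModulus W f ∧
        ∃ p ∈ {x'} ×ˢ (y • wordBall L (A * wordLength K (x⁻¹ * x') + A)), f p = 1 := by
  refine ⟨fun hf => ⟨hf.lipschitz, hf.hasLeftModulus, fun x y x' hxy => ⟨hf.hasLeftModulus, ?_⟩⟩,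
    fun ⟨hlip, hmod, htot⟩ => ⟨hmod, hlip, fun hne x' => ?_⟩⟩
  · obtain ⟨y', hy'⟩ := hf.leftTotal (fun h => hxy (congrFun h _)) x'
    refine ⟨(x', y'), ⟨rfl, Set.mem_smul_set_iff_inv_smul_mem.2 ?_⟩, hy'⟩
    exact hf.lipschitz hxy (hy'.trans_ne one_ne_zero)
  · obtain ⟨⟨x, y⟩, hxy⟩ := Function.ne_iff.1 hne
    obtain ⟨-, ⟨_, y'⟩, ⟨rfl, -⟩, hy'⟩ := htot x y x' hxy
    exact ⟨y', hy'⟩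

variable [TopologicalSpace G] [IsTopologicalGroup G] [TopologicalSpace H] [IsTopologicalGroup H]

theorem isClosed_setOf_isCoarseMapKernel (hL : IsCompact L) (hLgen : Subgroup.closure L = ⊤)
    (hW : Tendsto W (𝓝 1) (𝓝 0)) : IsClosed {f | IsCoarseMapKernel K L W A f} := by
  have hopen (p : G × H) : IsOpen {f : G × H → unitInterval | f p ≠ 0} :=
    isOpen_ne_fun (continuous_apply p) continuous_const
  have hball (x' : G) (y : H) (n : ℕ) : IsCompact ({x'} ×ˢ (y • wordBall L n) : Set (G × H)) :=
    isCompact_singleton.prod ((isCompact_wordBall hL hLgen n).smul y)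
  simp only [isCoarseMapKernel_iff, Set.ofPred_and, Set.ofPred_forall]
  refine (isClosed_setOf_coarselyLipschitz fun x y => hopen (x, y)).inter
    (isClosed_setOf_hasLeftModulus.inter ?_)
  exact isClosed_iInter fun x => isClosed_iInter fun y => isClosed_iInter fun x' =>
    isClosed_imp (hopen (x, y)) (isClosed_setOf_hasLeftModulus_and_exists_eq hW (hball x' y _) 1)

theorem isClosed_setOf_isCoarseKernel (hK : IsCompact K) (hKgen : Subgroup.closure K = ⊤)
    (hL : IsCompact L) (hLgen : Subgroup.closure L = ⊤) (hW : Tendsto W (𝓝 1) (𝓝 0)) :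
    IsClosed {f | IsCoarseKernel K L W A B f} :=
  (isClosed_setOf_isCoarseMapKernel hL hLgen hW).inter <|
    (isClosed_setOf_isCoarseMapKernel hK hKgen
      (hW.comp (continuous_swap.tendsto' 1 1 rfl))).preimage (by fun_prop)

end CoarseKernel

section CouplingSpace

theorem isClosed_setOf_smul_inter_nonempty {M X : Type*} [TopologicalSpace M] [TopologicalSpace X]
    [T2Space X] [SMul M X] [ContinuousSMul M X] {C : Set X} (hC : IsCompact C) :
    IsClosed {m : M | ((m • C) ∩ C).Nonempty} := by
  convert isClosed_setOf_exists_mem_of_isCompact hC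
    (hC.isClosed.preimage (continuous_smul (M := M))) using 1
  ext m
  exact Set.image_inter_nonempty_iff

variable {G : Type*} {H : Type*} [Group G] [Group H] {K : Set G} {L : Set H}
  {W : G × H → ℝ} {A B : ℕ}

theorem CoarselyLipschitz.mem_wordBall_of_translate {R : G → H → Prop}
    (hK : Subgroup.closure K = ⊤) (hL : Subgroup.closure L = ⊤) (hR : CoarselyLipschitz K L A R)
    {n : ℕ} {x x' : G} {y y' h : H} (hx : x ∈ wordBall K n) (hx' : x' ∈ wordBall K n)
    (hy : y ∈ wordBall L n) (hy' : y' ∈ wordBall L n) (hxy : R x y) (hxy' : R x' (h * y')) :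
    h ∈ wordBall L (n + (A * (n + n) + A) + n) := by
  have hxx' : wordLength K (x⁻¹ * x') ≤ n + n :=
    (wordLength_mul_le hK _ _).trans (add_le_add (by rwa [wordLength_inv hK]) hx')
  calc wordLength L h = wordLength L (y * (y⁻¹ * (h * y')) * y'⁻¹) := by group
    _ ≤ wordLength L y + wordLength L (y⁻¹ * (h * y')) + wordLength L y'⁻¹ :=
      (wordLength_mul_le hL _ _).trans (Nat.add_le_add_right (wordLength_mul_le hL _ _) _)
    _ ≤ n + (A * (n + n) + A) + n := by
      gcongr
      · exact hy
      · exact (hR hxy hxy').trans (by gcongr)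
      · rwa [wordLength_inv hL]

/-- The nonzero coarse kernels with fixed modulus and constants, in the topology of pointwise
convergence. -/
abbrev CouplingSpace (K : Set G) (L : Set H) (W : G × H → ℝ) (A B : ℕ) : Type _ :=
  {f : G × H → unitInterval // IsCoarseKernel K L W A B f ∧ f ≠ 0}

namespace CouplingSpace

instance : MulAction (G × H) (CouplingSpace K L W A B) where
  smul γ f := ⟨fun p => f.1 (γ⁻¹ * p), f.2.1.comp_mul_left γ⁻¹, fun h => f.2.2 <| by
    funext p
    simpa using congrFun h (γ * p)⟩
  one_smul f := Subtype.ext <| funext fun p => congrArg f.1 (by simp)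
  mul_smul γ δ f := Subtype.ext <| funext fun p => congrArg f.1 (by simp [mul_assoc])

instance : MulAction G (CouplingSpace K L W A B) :=
  .compHom _ (MonoidHom.inl G H)

instance : MulAction Hᵐᵒᵖ (CouplingSpace K L W A B) where
  smul h f := ((1, h.unop⁻¹) : G × H) • f
  one_smul f := by
    change ((1, 1⁻¹) : G × H) • f = f
    rw [inv_one]
    exact one_smul (G × H) f
  mul_smul h k f := by
    change ((1, (h * k).unop⁻¹) : G × H) • f =
      ((1, h.unop⁻¹) : G × H) • ((1, k.unop⁻¹) : G × H) • f
    rw [smul_smul]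
    simp

theorem smul_apply (g : G) (f : CouplingSpace K L W A B) (x : G) (y : H) :
    (g • f).1 (x, y) = f.1 (g⁻¹ * x, y) := by
  change f.1 ((g, 1)⁻¹ * (x, y)) = _
  simp

theorem op_smul_apply (h : H) (f : CouplingSpace K L W A B) (x : G) (y : H) :
    (MulOpposite.op h • f).1 (x, y) = f.1 (x, h * y) := by
  change f.1 ((1, h⁻¹)⁻¹ * (x, y)) = _
  simp

theorem exists_apply_right_eq_one (f : CouplingSpace K L W A B) (x : G) : ∃ y, f.1 (x, y) = 1 :=
  f.2.1.1.leftTotal f.2.2 x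

theorem exists_apply_left_eq_one (f : CouplingSpace K L W A B) (y : H) : ∃ x, f.1 (x, y) = 1 :=
  f.2.1.2.leftTotal
    (fun h => f.2.2 (Prod.swap_surjective.injective_comp_right h)) y

theorem iUnion_smul_eq_univ :
    ⋃ g : G, g • {f : CouplingSpace K L W A B | f.1 1 = 1} = Set.univ := by
  refine Set.iUnion_eq_univ_iff.2 fun f => ?_
  obtain ⟨x, hx⟩ := f.exists_apply_left_eq_one 1
  refine ⟨x, Set.mem_smul_set_iff_inv_smul_mem.2 ?_⟩
  rw [Set.mem_ofPred_eq, Prod.one_eq_mk, smul_apply, inv_inv, mul_one, hx]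

theorem iUnion_op_smul_eq_univ :
    ⋃ h : H, MulOpposite.op h • {f : CouplingSpace K L W A B | f.1 1 = 1} = Set.univ := by
  refine Set.iUnion_eq_univ_iff.2 fun f => ?_
  obtain ⟨y, hy⟩ := f.exists_apply_right_eq_one 1
  refine ⟨y⁻¹, Set.mem_smul_set_iff_inv_smul_mem.2 ?_⟩
  rw [Set.mem_ofPred_eq, Prod.one_eq_mk, ← MulOpposite.op_inv, op_smul_apply, inv_inv, mul_one, hy]

theorem isOpen_setOf_apply_ne_zero (p : G × H) :
    IsOpen {f : CouplingSpace K L W A B | f.1 p ≠ 0} :=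
  isOpen_ne_fun ((continuous_apply p).comp continuous_subtype_val) continuous_const

theorem exists_mem_wordBall_of_isCompact {C : Set (CouplingSpace K L W A B)} (hC : IsCompact C) :
    ∃ n, ∀ f ∈ C, ∃ x ∈ wordBall K n, ∃ y ∈ wordBall L n, f.1 (x, y) ≠ 0 := by
  let U (n : ℕ) : Set (CouplingSpace K L W A B) :=
    ⋃ x ∈ wordBall K n, ⋃ y ∈ wordBall L n, {f | f.1 (x, y) ≠ 0}
  have hopen (n : ℕ) : IsOpen (U n) :=
    isOpen_biUnion fun x _ => isOpen_biUnion fun y _ => isOpen_setOf_apply_ne_zero (x, y)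
  have hmono : Monotone U := fun m n hmn =>
    Set.biUnion_mono (wordBall_mono hmn) fun _ _ =>
      Set.biUnion_mono (wordBall_mono hmn) fun _ _ => le_rfl
  have hcover : C ⊆ ⋃ n, U n := fun f _ => by
    obtain ⟨⟨x, y⟩, hxy⟩ := Function.ne_iff.1 f.2.2
    simp only [U, Set.mem_iUnion]
    exact ⟨max (wordLength K x) (wordLength L y), x, le_max_left (wordLength K x) _,
      y, le_max_right _ (wordLength L y), hxy⟩
  obtain ⟨n, hn⟩ := hC.elim_directed_cover U hopen hcover hmono.directed_le
  exact ⟨n, fun f hf => by simpa [U] using hn hf⟩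

theorem locallyCompactSpace (hclosed : IsClosed {f | IsCoarseKernel K L W A B f}) :
    LocallyCompactSpace (CouplingSpace K L W A B) :=
  (hclosed.isLocallyClosed.inter isOpen_ne.isLocallyClosed).locallyCompactSpace

theorem isCompact_setOf_apply_one_eq_one (hclosed : IsClosed {f | IsCoarseKernel K L W A B f}) :
    IsCompact {f : CouplingSpace K L W A B | f.1 1 = 1} := by
  have hone : IsClosed {f : G × H → unitInterval | f 1 = 1} :=
    isClosed_eq (continuous_apply 1) continuous_const
  refine Subtype.isCompact_iff.2 ?_
  convert (hclosed.inter hone).isCompact using 1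
  ext f
  constructor
  · rintro ⟨f, hf, rfl⟩
    exact ⟨f.2.1, hf⟩
  · rintro ⟨hf, hf₁⟩
    exact ⟨⟨f, hf, fun h => zero_ne_one ((congrFun h 1).symm.trans hf₁)⟩, hf₁, rfl⟩

variable [TopologicalSpace G] [IsTopologicalGroup G] [TopologicalSpace H] [IsTopologicalGroup H]

theorem continuousSMul (hW : Tendsto W (𝓝 1) (𝓝 0)) :
    ContinuousSMul (G × H) (CouplingSpace K L W A B) where
  continuous_smul := by
    have heval : Continuous fun q : CouplingSpace K L W A B × (G × H) => q.1.1 q.2 :=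
      continuous_uncurry_of_hasLeftModulus hW (fun f => f.2.1.1.hasLeftModulus)
        fun p => (continuous_apply p).comp continuous_subtype_val
    refine Continuous.subtype_mk (continuous_pi fun p => ?_) _
    exact heval.comp (by fun_prop :
      Continuous fun q : (G × H) × CouplingSpace K L W A B => (q.2, q.1⁻¹ * p))

theorem isCompact_transporter_left (hK : IsCompact K) (hKgen : Subgroup.closure K = ⊤)
    (hLgen : Subgroup.closure L = ⊤) (hW : Tendsto W (𝓝 1) (𝓝 0))
    {C : Set (CouplingSpace K L W A B)} (hC : IsCompact C) :
    IsCompact {g : G | ((g • C) ∩ C).Nonempty} := by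
  have := continuousSMul (K := K) (L := L) (A := A) (B := B) hW
  obtain ⟨n, hn⟩ := exists_mem_wordBall_of_isCompact hC
  refine (isCompact_wordBall hK hKgen (n + (B * (n + n) + B) + n)).of_isClosed_subset
    ((isClosed_setOf_smul_inter_nonempty (M := G × H) hC).preimage
      (by fun_prop : Continuous fun g : G => ((g, 1) : G × H))) ?_
  rintro g ⟨_, ⟨f, hf, rfl⟩, hgf⟩
  obtain ⟨x, hx, y, hy, hxy⟩ := hn f hf
  obtain ⟨x', hx', y', hy', hxy'⟩ := hn _ hgf
  rw [smul_apply] at hxy'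
  simpa [mem_wordBall, wordLength_inv hKgen] using
    f.2.1.2.lipschitz.mem_wordBall_of_translate hLgen hKgen hy hy' hx hx' hxy hxy'

theorem isCompact_transporter_right (hKgen : Subgroup.closure K = ⊤) (hL : IsCompact L)
    (hLgen : Subgroup.closure L = ⊤) (hW : Tendsto W (𝓝 1) (𝓝 0))
    {C : Set (CouplingSpace K L W A B)} (hC : IsCompact C) :
    IsCompact {h : H | ((MulOpposite.op h • C) ∩ C).Nonempty} := by
  have := continuousSMul (K := K) (L := L) (A := A) (B := B) hW
  obtain ⟨n, hn⟩ := exists_mem_wordBall_of_isCompact hC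
  refine (isCompact_wordBall hL hLgen (n + (A * (n + n) + A) + n)).of_isClosed_subset
    ((isClosed_setOf_smul_inter_nonempty (M := G × H) hC).preimage
      (by fun_prop : Continuous fun h : H => ((1, h⁻¹) : G × H))) ?_
  rintro h ⟨_, ⟨f, hf, rfl⟩, hhf⟩
  obtain ⟨x, hx, y, hy, hxy⟩ := hn f hf
  obtain ⟨x', hx', y', hy', hxy'⟩ := hn _ hhf
  rw [op_smul_apply] at hxy'
  exact f.2.1.1.lipschitz.mem_wordBall_of_translate hKgen hLgen hx hx' hy hy' hxy hxy'

theorem isTopologicalCoupling (hK : IsCompact K) (hKgen : Subgroup.closure K = ⊤)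
    (hL : IsCompact L) (hLgen : Subgroup.closure L = ⊤) (hW : Tendsto W (𝓝 1) (𝓝 0))
    (hne : Nonempty (CouplingSpace K L W A B)) :
    IsTopologicalCoupling G H (CouplingSpace K L W A B) := by
  have := continuousSMul (K := K) (L := L) (A := A) (B := B) hW
  have hclosed := isClosed_setOf_isCoarseKernel (A := A) (B := B) hK hKgen hL hLgen hW
  have hsmul := continuous_smul (M := G × H) (X := CouplingSpace K L W A B)
  exact
    { nonempty := hne
      t2Space := inferInstance
      locallyCompactSpace := locallyCompactSpace hclosed
      continuous_left := hsmul.comp (by fun_prop :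
        Continuous fun p : G × CouplingSpace K L W A B => (((p.1, 1) : G × H), p.2))
      continuous_right := hsmul.comp (by fun_prop :
        Continuous fun p : CouplingSpace K L W A B × H => (((1, p.2⁻¹) : G × H), p.1))
      comm := fun g h f => Subtype.ext <| funext fun p => by
        rw [← Prod.mk.eta (p := p), smul_apply, op_smul_apply, op_smul_apply, smul_apply]
      proper_left := fun C hC => isCompact_transporter_left hK hKgen hLgen hW hC
      proper_right := fun C hC => isCompact_transporter_right hKgen hL hLgen hW hC
      cocompact := ⟨_, isCompact_setOf_apply_one_eq_one hclosed,
        iUnion_smul_eq_univ, iUnion_op_smul_eq_univ⟩ }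

end CouplingSpace

end CouplingSpace

section CouplingOfCorrespondence

theorem exists_unitInterval_bump {X : Type*} [TopologicalSpace X] [RegularSpace X]
    [LocallyCompactSpace X] (x : X) :
    ∃ b : X → unitInterval, Continuous b ∧ HasCompactSupport b ∧ b x = 1 := by
  obtain ⟨f, hfx, -, hsupp, -⟩ := exists_continuous_one_zero_of_isCompact
    (isCompact_singleton (x := x)) isClosed_empty (Set.disjoint_empty _)
  refine ⟨Set.projIcc 0 1 zero_le_one ∘ f, continuous_projIcc.comp f.continuous,
    hsupp.comp_left (Set.projIcc_left zero_le_one), ?_⟩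
  simp [hfx rfl]

variable {G : Type*} {H : Type*} [Group G] [Group H] {K : Set G} {L : Set H} {R : G → H → Prop}

theorem IsCoarseCorrespondence.exists_isCoarseKernel (hR : IsCoarseCorrespondence K L R)
    (hK : Subgroup.closure K = ⊤) (hL : Subgroup.closure L = ⊤) {W : G × H → ℝ}
    {f : G × H → unitInterval} (hmod : HasLeftModulus W f)
    (hone : ∀ ⦃x y⦄, R x y → f (x, y) = 1) {n : ℕ}
    (hclose : ∀ ⦃x y⦄, f (x, y) ≠ 0 →
      ∃ a b, R a b ∧ a⁻¹ * x ∈ wordBall K n ∧ b⁻¹ * y ∈ wordBall L n) :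
    ∃ A B, IsCoarseKernel K L W A B f := by
  obtain ⟨A, hA⟩ := hR.lipschitz
  obtain ⟨B, hB⟩ := hR.lipschitz_flip
  have hclose_flip ⦃y x⦄ (hxy : f (x, y) ≠ 0) :
      ∃ b a, flip R b a ∧ b⁻¹ * y ∈ wordBall L n ∧ a⁻¹ * x ∈ wordBall K n := by
    obtain ⟨a, b, hab, hax, hby⟩ := hclose hxy
    exact ⟨b, a, hab, hby, hax⟩
  exact ⟨_, _,
    ⟨hmod, hA.of_close hK hL hclose, fun _ x => (hR.leftTotal x).imp fun _ hxy => hone hxy⟩,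
    ⟨fun p q => hmod p.swap q.swap, hB.of_close hL hK hclose_flip,
      fun _ y => (hR.rightTotal y).imp fun _ hxy => hone hxy⟩⟩

variable [TopologicalSpace G] [IsTopologicalGroup G] [T2Space G] [LocallyCompactSpace G]
  [TopologicalSpace H] [IsTopologicalGroup H] [T2Space H] [LocallyCompactSpace H]

theorem IsCoarseCorrespondence.exists_nonempty_couplingSpace (hR : IsCoarseCorrespondence K L R)
    (hK : IsCompact K) (hKgen : Subgroup.closure K = ⊤) (hL : IsCompact L)
    (hLgen : Subgroup.closure L = ⊤) :
    ∃ W A B, Tendsto W (𝓝 1) (𝓝 0) ∧ Nonempty (CouplingSpace K L W A B) := by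
  obtain ⟨b, hb, hsupp, hb_one⟩ := exists_unitInterval_bump (1 : G × H)
  obtain ⟨W, hW, hmod⟩ := exists_hasLeftModulus_of_hasCompactSupport hb hsupp
  obtain ⟨m, hm⟩ := exists_subset_wordBall_of_isCompact hK hKgen (hsupp.image continuous_fst)
  obtain ⟨n, hn⟩ := exists_subset_wordBall_of_isCompact hL hLgen (hsupp.image continuous_snd)
  let f := smear {r : G × H | R r.1 r.2} b
  have hone ⦃x y⦄ (hxy : R x y) : f (x, y) = 1 := smear_eq_one hb_one hxy
  have hclose ⦃x y⦄ (hxy : f (x, y) ≠ 0) : ∃ a c, R a c ∧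
      a⁻¹ * x ∈ wordBall K (max m n) ∧ c⁻¹ * y ∈ wordBall L (max m n) := by
    obtain ⟨⟨a, c⟩, hac, hmem⟩ := exists_mem_of_smear_ne_zero hxy
    have hmem : (a⁻¹ * x, c⁻¹ * y) ∈ tsupport b := subset_tsupport b hmem
    exact ⟨a, c, hac, wordBall_mono (le_max_left m n) (hm ⟨_, hmem, rfl⟩),
      wordBall_mono (le_max_right m n) (hn ⟨_, hmem, rfl⟩)⟩
  obtain ⟨y, hy⟩ := hR.leftTotal 1
  obtain ⟨A, B, hf⟩ := hR.exists_isCoarseKernel hKgen hLgen (hmod.smear ⟨(1, y), hy⟩) hone hclose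
  have hne : f ≠ 0 := fun h => zero_ne_one ((congrFun h (1, y)).symm.trans (hone hy))
  exact ⟨W, A, B, hW, ⟨f, hf, hne⟩⟩

end CouplingOfCorrespondence

section CorrespondenceOfCoupling

variable {G : Type u} {H : Type v} {X : Type w} [Group G] [Group H] [MulAction G X]
  [MulAction Hᵐᵒᵖ X] {x₀ : X} {C : Set X}

/-- The relation between `g` and `h` that `g⁻¹ x₀ h` lies in `C`: the coarse correspondence read off
a coupling from a base point `x₀` and a compact fundamental set `C`. -/
def returnRelation (x₀ : X) (C : Set X) (g : G) (h : H) : Prop :=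
  g⁻¹ • MulOpposite.op h • x₀ ∈ C

theorem rightTotal_returnRelation (hC : ⋃ g : G, g • C = Set.univ) :
    Relator.RightTotal (returnRelation (G := G) (H := H) x₀ C) := by
  intro h
  obtain ⟨g, hg⟩ := Set.iUnion_eq_univ_iff.1 hC (MulOpposite.op h • x₀)
  exact ⟨g, Set.mem_smul_set_iff_inv_smul_mem.1 hg⟩

variable [TopologicalSpace G] [TopologicalSpace H] [TopologicalSpace X] {K : Set G} {L : Set H}

namespace IsTopologicalCoupling

theorem leftTotal_returnRelation (hX : IsTopologicalCoupling G H X)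
    (hC : ⋃ h : H, MulOpposite.op h • C = Set.univ) :
    Relator.LeftTotal (returnRelation (G := G) (H := H) x₀ C) := by
  intro g
  obtain ⟨h, hh⟩ := Set.iUnion_eq_univ_iff.1 hC (g⁻¹ • x₀)
  refine ⟨h⁻¹, ?_⟩
  rwa [Set.mem_smul_set_iff_inv_smul_mem, ← MulOpposite.op_inv, ← hX.comm] at hh

theorem op_smul_inv_smul_eq (hX : IsTopologicalCoupling G H X) (g g' : G) (h h' : H) :
    MulOpposite.op (h⁻¹ * h') • g⁻¹ • MulOpposite.op h • x₀ =
      (g⁻¹ * g') • g'⁻¹ • MulOpposite.op h' • x₀ := by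
  rw [← hX.comm, smul_smul (MulOpposite.op _), ← MulOpposite.op_mul, mul_inv_cancel_left,
    smul_smul (g⁻¹ * g'), mul_assoc, mul_inv_cancel, mul_one]

theorem exists_mem_wordBall_right [IsTopologicalGroup H] [T2Space H] [BaireSpace H]
    (hX : IsTopologicalCoupling G H X) (hL : IsCompact L) (hLgen : Subgroup.closure L = ⊤)
    (hC : IsCompact C) {S : Set G} (hS : IsCompact S) :
    ∃ n, ∀ (h : H), ∀ c ∈ C, ∀ s ∈ S, ∀ c' ∈ C, MulOpposite.op h • c = s • c' →
      h ∈ wordBall L n := by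
  have hD := hC.union ((hS.prod hC).image hX.continuous_left)
  obtain ⟨n, hn⟩ := exists_subset_wordBall_of_isCompact hL hLgen (hX.proper_right _ hD)
  exact ⟨n, fun h c hc s hs c' hc' heq =>
    hn ⟨_, ⟨c, Or.inl hc, rfl⟩, Or.inr ⟨(s, c'), ⟨hs, hc'⟩, heq.symm⟩⟩⟩

theorem exists_mem_wordBall_left [IsTopologicalGroup G] [T2Space G] [BaireSpace G]
    (hX : IsTopologicalCoupling G H X) (hK : IsCompact K) (hKgen : Subgroup.closure K = ⊤)
    (hC : IsCompact C) {T : Set H} (hT : IsCompact T) :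
    ∃ n, ∀ (g : G), ∀ c ∈ C, ∀ t ∈ T, ∀ c' ∈ C, g • c = MulOpposite.op t • c' →
      g ∈ wordBall K n := by
  have hD := hC.union ((hC.prod hT).image hX.continuous_right)
  obtain ⟨n, hn⟩ := exists_subset_wordBall_of_isCompact hK hKgen (hX.proper_left _ hD)
  exact ⟨n, fun g c hc t ht c' hc' heq =>
    hn ⟨_, ⟨c, Or.inl hc, rfl⟩, Or.inr ⟨(c', t), ⟨hc', ht⟩, heq.symm⟩⟩⟩

variable [IsTopologicalGroup G] [T2Space G] [BaireSpace G] [IsTopologicalGroup H] [T2Space H]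
  [BaireSpace H]

theorem exists_isCoarseCorrespondence (hX : IsTopologicalCoupling G H X)
    (hK : IsCompact K) (hKgen : Subgroup.closure K = ⊤)
    (hL : IsCompact L) (hLgen : Subgroup.closure L = ⊤) :
    ∃ R : G → H → Prop, IsCoarseCorrespondence K L R := by
  obtain ⟨x₀⟩ := hX.nonempty
  obtain ⟨C, hC, hGC, hCH⟩ := hX.cocompact
  obtain ⟨m, hm⟩ := hX.exists_mem_wordBall_right hL hLgen hC ((hK.union hK.inv).insert 1)
  obtain ⟨n, hn⟩ := hX.exists_mem_wordBall_left hK hKgen hC ((hL.union hL.inv).insert 1)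
  have hleft := hX.leftTotal_returnRelation (x₀ := x₀) hCH
  have hright := rightTotal_returnRelation (H := H) (x₀ := x₀) hGC
  refine ⟨returnRelation x₀ C, hleft, hright,
    ⟨m, .of_generators hKgen hLgen hleft fun g h s h' hs hgh hgh' => ?_⟩,
    ⟨n, .of_generators hLgen hKgen hright fun h g t g' ht hgh hgh' => ?_⟩⟩
  · exact hm _ _ hgh s hs _ hgh' (by simpa using hX.op_smul_inv_smul_eq g (g * s) h h')
  · exact hn _ _ hgh' t ht _ hgh (by simpa using (hX.op_smul_inv_smul_eq g g' h (h * t)).symm)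

end IsTopologicalCoupling

end CorrespondenceOfCoupling

section Transport

namespace IsTopologicalCoupling

variable {G : Type u} {H : Type v} [Group G] [TopologicalSpace G] [Group H] [TopologicalSpace H]

theorem of_homeomorph {X Y : Type*} [TopologicalSpace X] [MulAction G X] [MulAction Hᵐᵒᵖ X]
    [TopologicalSpace Y] [MulAction G Y] [MulAction Hᵐᵒᵖ Y] (hX : IsTopologicalCoupling G H X)
    (E : Y ≃ₜ X) (hG : ∀ (g : G) y, E (g • y) = g • E y)
    (hH : ∀ (h : Hᵐᵒᵖ) y, E (h • y) = h • E y) : IsTopologicalCoupling G H Y := by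
  have := hX.nonempty
  have := hX.t2Space
  have := hX.locallyCompactSpace
  have image_smul (g : G) (C : Set Y) : E '' (g • C) = g • E '' C :=
    Set.image_smul_comm _ _ _ (hG g)
  have image_op_smul (h : H) (C : Set Y) :
      E '' (MulOpposite.op h • C) = MulOpposite.op h • E '' C :=
    Set.image_smul_comm _ _ _ (hH _)
  exact
    { nonempty := E.toEquiv.nonempty
      t2Space := E.isEmbedding.t2Space
      locallyCompactSpace := E.isOpenEmbedding.locallyCompactSpace
      continuous_left := E.comp_continuous_iff.1 <| (hX.continuous_left.comp
        (by fun_prop : Continuous fun p : G × Y => (p.1, E p.2))).congr fun p => (hG _ _).symm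
      continuous_right := E.comp_continuous_iff.1 <| (hX.continuous_right.comp
        (by fun_prop : Continuous fun p : Y × H => (E p.1, p.2))).congr fun p => (hH _ _).symm
      comm := fun g h y => E.injective (by simp only [hG, hH, hX.comm])
      proper_left := fun C hC => by
        convert hX.proper_left _ (hC.image E.continuous) using 3 with g
        rw [← image_smul, ← Set.image_inter E.injective, Set.image_nonempty]
      proper_right := fun C hC => by
        convert hX.proper_right _ (hC.image E.continuous) using 3 with h
        rw [← image_op_smul, ← Set.image_inter E.injective, Set.image_nonempty]
      cocompact := by
        obtain ⟨C, hC, hGC, hCH⟩ := hX.cocompact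
        have hEC : E '' (E ⁻¹' C) = C := E.image_preimage C
        refine ⟨E ⁻¹' C, E.isCompact_preimage.2 hC, E.injective.image_injective ?_,
          E.injective.image_injective ?_⟩
        · simp only [Set.image_iUnion, image_smul, hEC, hGC, Set.image_univ, E.range_coe]
        · simp only [Set.image_iUnion, image_op_smul, hEC, hCH, Set.image_univ, E.range_coe] }

theorem admitTopologicalCoupling {X : Type*} [TopologicalSpace X] [MulAction G X]
    [MulAction Hᵐᵒᵖ X] [Small.{w} X] (hX : IsTopologicalCoupling G H X) :
    AdmitTopologicalCoupling.{u, v, w} G H := by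
  let e : Shrink.{w} X ≃ X := (equivShrink X).symm
  let _ : TopologicalSpace (Shrink.{w} X) := .induced e inferInstance
  let _ : MulAction G (Shrink.{w} X) := e.mulAction G
  let _ : MulAction Hᵐᵒᵖ (Shrink.{w} X) := e.mulAction Hᵐᵒᵖ
  exact ⟨Shrink.{w} X, inferInstance, inferInstance, inferInstance,
    hX.of_homeomorph (e.toHomeomorphOfIsInducing ⟨rfl⟩)
      (fun _ _ => e.apply_symm_apply _) fun _ _ => e.apply_symm_apply _⟩

end IsTopologicalCoupling

end Transport

theorem small_of_secondCountableTopology (X : Type u) [TopologicalSpace X] [T0Space X]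
    [SecondCountableTopology X] : Small.{w} X := by
  obtain ⟨b, hb, -, hbasis⟩ := TopologicalSpace.exists_countable_basis X
  have := hb.to_subtype
  refine small_of_injective (β := Set b) (f := fun x => {s | x ∈ s.1}) fun x y hxy => ?_
  exact (hbasis.eq_iff).2 fun s hs => Set.ext_iff.1 hxy ⟨s, hs⟩

theorem mainTheorem2_general (G : Type u) (H : Type v)
    [Group G] [TopologicalSpace G] [IsTopologicalGroup G] [T2Space G]
    [LocallyCompactSpace G] [Small.{w} G]
    [Group H] [TopologicalSpace H] [IsTopologicalGroup H] [T2Space H]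
    [LocallyCompactSpace H] [Small.{w} H]
    (K : Set G) (hK : IsCompact K) (hKgen : Subgroup.closure K = ⊤)
    (L : Set H) (hL : IsCompact L) (hLgen : Subgroup.closure L = ⊤) :
    (∃ φ : G → H, IsQuasiIsometry (wordDist K) (wordDist L) φ) ↔
      AdmitTopologicalCoupling.{u, v, w} G H := by
  constructor
  · rintro ⟨φ, hφ⟩
    obtain ⟨R, hR⟩ := hφ.exists_isCoarseCorrespondence hKgen hLgen
    obtain ⟨W, A, B, hW, hne⟩ := hR.exists_nonempty_couplingSpace hK hKgen hL hLgen
    exact (CouplingSpace.isTopologicalCoupling hK hKgen hL hLgen hW hne).admitTopologicalCoupling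
  · rintro ⟨X, _, _, _, hX⟩
    obtain ⟨R, hR⟩ := hX.exists_isCoarseCorrespondence hK hKgen hL hLgen
    exact hR.exists_isQuasiIsometry

theorem mainTheorem2 (G : Type u) (H : Type v)
    [Group G] [TopologicalSpace G] [IsTopologicalGroup G] [T2Space G]
    [LocallyCompactSpace G] [SecondCountableTopology G]
    [Group H] [TopologicalSpace H] [IsTopologicalGroup H] [T2Space H]
    [LocallyCompactSpace H] [SecondCountableTopology H]
    (K : Set G) (hK : IsCompact K) (hKgen : Subgroup.closure K = ⊤)
    (L : Set H) (hL : IsCompact L) (hLgen : Subgroup.closure L = ⊤) :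
    (∃ φ : G → H, IsQuasiIsometry (wordDist K) (wordDist L) φ) ↔
      AdmitTopologicalCoupling.{u, v, w} G H := by
  have := small_of_secondCountableTopology.{u, w} G
  have := small_of_secondCountableTopology.{v, w} H
  exact mainTheorem2_general G H K hK hKgen L hL hLgen
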